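/- Let $n \ge 1$ and let $K_{2n}$ be the complete graph on the vertex set $[2n]$. A family $\mathcal{F}$ of perfect matchings of $K_{2n}$ is \emph{intersecting} if any two members of $\mathcal{F}$ share an edge, and it is a \emph{maximum} intersecting family if it is intersecting and no intersecting family of perfect matchings of $K_{2n}$ has more members. For distinct $i, j \in [2n]$, let $\mathcal{F}_{ij}$ be the family of all perfect matchings of $K_{2n}$ that contain the edge $\{i,j\}$; the families of this form are called \emph{trivially intersecting}. Every maximum intersecting family of perfect matchings of $K_{2n}$ is trivially intersecting, that is, equals $\mathcal{F}_{ij}$ for some $i \neq j$. Moreover, an intersecting family $\mathcal{F}$ of perfect matchings of $K_{2n}$ satisfies $|\mathcal{F}| = (2(n-1)-1)!!$ if and only if $\mathcal{F} = \mathcal{F}_{ij}$ for some $i \neq j$ (with the convention $(-1)!! = 1$). -/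

import Mathlib

open scoped Nat

/-- The perfect matchings of the complete graph `K_{2n}` on the vertex set `Fin (2 * n)`. -/
abbrev PerfectMatching (n : ℕ) : Type :=
  {m : (⊤ : SimpleGraph (Fin (2 * n))).Subgraph // m.IsPerfectMatching}

/-- A family of perfect matchings of `K_{2n}` is intersecting if any two of its members
share an edge. -/
def IsIntersectingFamily {n : ℕ} (F : Set (PerfectMatching n)) : Prop :=
  ∀ m ∈ F, ∀ m' ∈ F, (m.1.edgeSet ∩ m'.1.edgeSet).Nonempty

/-- A maximum intersecting family: an intersecting family of the largest possible size.
(There are finitely many perfect matchings, so `Set.ncard` is the usual cardinality.) -/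
def IsMaximumIntersectingFamily {n : ℕ} (F : Set (PerfectMatching n)) : Prop :=
  IsIntersectingFamily F ∧
    ∀ G : Set (PerfectMatching n), IsIntersectingFamily G → G.ncard ≤ F.ncard

/-- The family `F_{ij}` of all perfect matchings of `K_{2n}` containing the edge `ij`. -/
def edgeFamily {n : ℕ} (i j : Fin (2 * n)) : Set (PerfectMatching n) :=
  {m | s(i, j) ∈ m.1.edgeSet}

/-- A family of perfect matchings is trivially intersecting if it equals `F_{ij}`
for some `i ≠ j`. -/
def IsTriviallyIntersecting {n : ℕ} (F : Set (PerfectMatching n)) : Prop :=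
  ∃ i j : Fin (2 * n), i ≠ j ∧ F = edgeFamily i j

/-! Perfect matchings are encoded as fixed-point-free involutions, on which the symmetric group acts
transitively by conjugation. A one-factorization consists of 2n-1 pairwise disjoint matchings, so an
intersecting family contains at most one of them. Averaging over all conjugates of one
one-factorization gives the bound (2n-3)!!, and a family attaining it meets every one-factorization
(`IsOneFactorization.card_mul_le`, `IsOneFactorization.exists_mem`).

For n ≥ 4, equality is analysed by switching. If the union of two factors contains a 4-cycle,
exchanging its opposite edges gives a new one-factorization, and F meets both exactly once. Hence if
M is in F and leaves F when p and q are exchanged, the second factor must enter F under the same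
exchange (`IsTransversalFamily.exchange`). That second factor can be chosen to contain an edge xy
away from p, q and their partners. Exchanging x and y then fixes it, so the information passes back
to M with x and y exchanged (`IsTransversalFamily.swapConj_mem`). By connectivity, F contains every
matching with the same edges as M at p and q, so each member of F must contain one of these two
edges. A second application of this dichotomy leaves a single common edge.

The one-factorizations come from Latin squares. For n ≤ 3 the families have at most three members
and are treated directly. -/

/-- A perfect matching of the complete graph on `V`, given by the fixed-point-free involution
that sends each vertex to its partner. -/
def IsMatchingPerm {V : Type} (M : Equiv.Perm V) : Prop :=
  ∀ x, M x ≠ x ∧ M (M x) = x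

/-- Any two members share an edge, that is, agree at some vertex. -/
def IsIntersectingPerms {V : Type} (F : Finset (Equiv.Perm V)) : Prop :=
  ∀ M ∈ F, ∀ N ∈ F, ∃ x, M x = N x

/-- A one-factorization of the complete graph on `V`: pairwise disjoint perfect matchings,
one fewer than there are vertices. -/
structure IsOneFactorization {V ι : Type} [Fintype V] [Fintype ι] (c : ι → Equiv.Perm V) :
    Prop where
  matching : ∀ i, IsMatchingPerm (c i)
  disjoint : ∀ i j x, c i x = c j x → i = j
  card : Fintype.card ι + 1 = Fintype.card V

/-! ### Counting matchings by conjugation, and the clique-coclique bound -/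

section

variable {V : Type}

theorem IsMatchingPerm.conj {M : Equiv.Perm V} (hM : IsMatchingPerm M) (σ : Equiv.Perm V) :
    IsMatchingPerm (σ * M * σ⁻¹) := by
  intro x
  refine ⟨fun h => (hM (σ⁻¹ x)).1 ?_, ?_⟩
  · rw [Equiv.Perm.eq_inv_iff_eq]; simpa using h
  · simp [(hM _).2]

theorem IsMatchingPerm.apply_eq_iff {M : Equiv.Perm V} (hM : IsMatchingPerm M) {x y : V} :
    M x = y ↔ M y = x :=
  ⟨fun h => h ▸ (hM x).2, fun h => h ▸ (hM y).2⟩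

theorem IsOneFactorization.conj {ι : Type} [Fintype V] [Fintype ι] {c : ι → Equiv.Perm V}
    (hc : IsOneFactorization c) (σ : Equiv.Perm V) :
    IsOneFactorization (fun i => σ * c i * σ⁻¹) where
  matching i := (hc.matching i).conj σ
  disjoint i j x h := hc.disjoint i j (σ⁻¹ x) (by simpa using h)
  card := hc.card

variable [Fintype V] [DecidableEq V]

open Classical in
/-- The set of all perfect matchings on `V`. -/
noncomputable def matchingPerms (V : Type) [Fintype V] [DecidableEq V] :
    Finset (Equiv.Perm V) :=
  Finset.univ.filter IsMatchingPerm

@[simp] theorem mem_matchingPerms {M : Equiv.Perm V} :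
    M ∈ matchingPerms V ↔ IsMatchingPerm M := by
  simp [matchingPerms]

theorem IsMatchingPerm.cycleType {M : Equiv.Perm V} (hM : IsMatchingPerm M) {n : ℕ}
    (hn : Fintype.card V = 2 * n) : M.cycleType = Multiset.replicate n 2 := by
  have h2 : M ^ 2 = 1 := by
    ext x; simp [pow_two, (hM x).2]
  have : Fact (Nat.Prime 2) := ⟨Nat.prime_two⟩
  have h := Equiv.Perm.cycleType_of_pow_prime_eq_one h2
  have hs : M.support = Finset.univ := by
    ext x; simp [(hM x).1]
  have hsum := M.sum_cycleType
  rw [hs, Finset.card_univ, hn, h, Multiset.sum_replicate, smul_eq_mul] at hsum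
  rw [h]
  congr 1
  omega

theorem IsMatchingPerm.exists_conj {M N : Equiv.Perm V} (hM : IsMatchingPerm M)
    (hN : IsMatchingPerm N) {n : ℕ} (hn : Fintype.card V = 2 * n) :
    ∃ σ : Equiv.Perm V, σ * M * σ⁻¹ = N := by
  rw [← isConj_iff, Equiv.Perm.isConj_iff_cycleType_eq, hM.cycleType hn, hN.cycleType hn]

/-- Matchings form one conjugacy class, whose centralizers have order 2 ^ n * n!. -/
theorem card_matchingPerms {n : ℕ} (hn : Fintype.card V = 2 * n) {M₀ : Equiv.Perm V}
    (hM₀ : IsMatchingPerm M₀) : (matchingPerms V).card * (2 ^ n * n !) = (2 * n)! := by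
  have h : matchingPerms V =
      Finset.univ.filter (fun g : Equiv.Perm V => g.cycleType = Multiset.replicate n 2) := by
    ext M
    simp only [mem_matchingPerms, Finset.mem_filter, Finset.mem_univ, true_and]
    refine ⟨fun h => h.cycleType hn, fun h => ?_⟩
    rw [← hM₀.cycleType hn, ← Equiv.Perm.isConj_iff_cycleType_eq, isConj_comm, isConj_iff] at h
    obtain ⟨σ, rfl⟩ := h
    exact hM₀.conj σ
  have h1 := Equiv.Perm.card_of_cycleType_mul_eq (α := V) (Multiset.replicate n 2)
  rw [← h] at h1
  rw [hn, if_pos ⟨by simp [mul_comm], fun a ha => (Multiset.eq_of_mem_replicate ha).ge⟩] at h1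
  rw [← h1]
  rcases Nat.eq_zero_or_pos n with rfl | hpos
  · simp
  · have : (Multiset.replicate n 2).toFinset = {2} := by
      rw [Multiset.toFinset_replicate, if_neg (by omega)]
    simp [this, mul_comm]

theorem card_matchingPerms_eq_doubleFactorial {n : ℕ} (hpos : 1 ≤ n)
    (hn : Fintype.card V = 2 * n) {M₀ : Equiv.Perm V} (hM₀ : IsMatchingPerm M₀) :
    (matchingPerms V).card = (2 * n - 1) * (2 * (n - 1) - 1)‼ := by
  have h := card_matchingPerms hn hM₀
  obtain ⟨m, rfl⟩ : ∃ m, n = m + 1 := ⟨n - 1, by omega⟩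
  have h1 := Nat.factorial_eq_mul_doubleFactorial (2 * m + 1)
  have h2 : (2 * (m + 1))‼ = 2 ^ (m + 1) * (m + 1)! := Nat.doubleFactorial_two_mul _
  -- With truncated subtraction, the case m = 0 reads 1‼ = 1 * 0‼.
  have h3 : (2 * m + 1)‼ = (2 * m + 1) * (2 * m - 1)‼ := by
    cases m with
    | zero => rfl
    | succ k => exact Nat.doubleFactorial_add_two _
  have e1 : 2 * m + 1 + 1 = 2 * (m + 1) := by ring
  rw [e1, h2, ← h, mul_comm] at h1
  have h4 := Nat.eq_of_mul_eq_mul_left (by positivity) h1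
  rw [h4, h3]
  congr 1

/-- All conjugation fibres between matchings have the same size. -/
theorem card_conj_fiber {n : ℕ} (hn : Fintype.card V = 2 * n) {M₀ M N : Equiv.Perm V}
    (hM₀ : IsMatchingPerm M₀) (hM : IsMatchingPerm M) (hN : IsMatchingPerm N) :
    (Finset.univ.filter fun σ : Equiv.Perm V => σ * M * σ⁻¹ = N).card =
      (Finset.univ.filter fun σ : Equiv.Perm V => σ * M₀ * σ⁻¹ = M₀).card := by
  obtain ⟨α, rfl⟩ := hM₀.exists_conj hM hn
  obtain ⟨β, rfl⟩ := hM₀.exists_conj hN hn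
  refine Finset.card_equiv ((Equiv.mulLeft β⁻¹).trans (Equiv.mulRight α)) fun σ => ?_
  simp only [Finset.mem_filter, Finset.mem_univ, true_and, Equiv.trans_apply,
    Equiv.coe_mulLeft, Equiv.coe_mulRight]
  constructor
  · intro h
    calc _ = β⁻¹ * (σ * (α * M₀ * α⁻¹) * σ⁻¹) * β := by group
      _ = _ := by rw [h]; group
  · intro h
    calc _ = β * (β⁻¹ * σ * α * M₀ * (β⁻¹ * σ * α)⁻¹) * β⁻¹ := by group
      _ = _ := by rw [h]

/-- Double counting of the pairs (σ, i) for which the conjugate of `c i` by σ lies in F: each i and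
each target in F contribute one conjugation fibre, and all fibres have the same size. -/
theorem sum_conj_fiber {ι : Type} [Fintype ι] {n : ℕ} (hn : Fintype.card V = 2 * n)
    {M₀ : Equiv.Perm V} (hM₀ : IsMatchingPerm M₀) {c : ι → Equiv.Perm V}
    (hc : ∀ i, IsMatchingPerm (c i)) {F : Finset (Equiv.Perm V)} (hF : F ⊆ matchingPerms V) :
    ∑ σ : Equiv.Perm V, (Finset.univ.filter fun i => σ * c i * σ⁻¹ ∈ F).card =
      Fintype.card ι * F.card *
        (Finset.univ.filter fun σ : Equiv.Perm V => σ * M₀ * σ⁻¹ = M₀).card := by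
  simp_rw [Finset.card_filter (fun i => _ ∈ F)]
  rw [Finset.sum_comm]
  have : ∀ i, ∑ σ : Equiv.Perm V, (if σ * c i * σ⁻¹ ∈ F then 1 else 0) =
      F.card * (Finset.univ.filter fun σ : Equiv.Perm V => σ * M₀ * σ⁻¹ = M₀).card := by
    intro i
    rw [← Finset.card_filter, Finset.card_eq_sum_card_fiberwise (t := F)
      (f := fun σ => σ * c i * σ⁻¹) (by intro σ hσ; simpa using hσ)]
    rw [← smul_eq_mul, ← Finset.sum_const]
    refine Finset.sum_congr rfl fun N hN => ?_
    rw [← card_conj_fiber hn hM₀ (hc i) (mem_matchingPerms.1 (hF hN)), Finset.filter_filter]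
    congr 1
    ext σ
    simp only [Finset.mem_filter, Finset.mem_univ, true_and, and_iff_right_iff_imp]
    rintro rfl
    exact hN
  rw [Finset.sum_congr rfl fun i _ => this i]
  simp [mul_assoc]

theorem IsOneFactorization.card_filter_le_one {ι : Type} [Fintype ι] {c : ι → Equiv.Perm V}
    (hc : IsOneFactorization c) {F : Finset (Equiv.Perm V)} (hF : IsIntersectingPerms F) :
    (Finset.univ.filter fun i => c i ∈ F).card ≤ 1 := by
  rw [Finset.card_le_one]
  intro i hi j hj
  simp only [Finset.mem_filter, Finset.mem_univ, true_and] at hi hj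
  obtain ⟨x, hx⟩ := hF _ hi _ hj
  exact hc.disjoint i j x hx

theorem card_perm_eq_card_matchingPerms_mul {n : ℕ} (hn : Fintype.card V = 2 * n)
    {M₀ : Equiv.Perm V} (hM₀ : IsMatchingPerm M₀) :
    Fintype.card (Equiv.Perm V) = (matchingPerms V).card *
      (Finset.univ.filter fun σ : Equiv.Perm V => σ * M₀ * σ⁻¹ = M₀).card := by
  have h := sum_conj_fiber (c := fun _ : Unit => M₀) hn hM₀ (fun _ => hM₀) (le_refl _)
  simpa [hM₀.conj] using h

theorem stabilizer_card_pos {M₀ : Equiv.Perm V} :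
    0 < (Finset.univ.filter fun σ : Equiv.Perm V => σ * M₀ * σ⁻¹ = M₀).card :=
  Finset.card_pos.2 ⟨1, by simp⟩

/-- The clique-coclique bound for intersecting families of perfect matchings. -/
theorem IsOneFactorization.card_mul_le {ι : Type} [Fintype ι] {c : ι → Equiv.Perm V}
    (hc : IsOneFactorization c) {n : ℕ} (hn : Fintype.card V = 2 * n) {M₀ : Equiv.Perm V}
    (hM₀ : IsMatchingPerm M₀) {F : Finset (Equiv.Perm V)} (hF : F ⊆ matchingPerms V)
    (hI : IsIntersectingPerms F) :
    Fintype.card ι * F.card ≤ (matchingPerms V).card := by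
  have h := sum_conj_fiber hn hM₀ hc.matching hF
  have h1 : ∑ σ : Equiv.Perm V, (Finset.univ.filter fun i => σ * c i * σ⁻¹ ∈ F).card ≤
      ∑ σ : Equiv.Perm V, 1 :=
    Finset.sum_le_sum fun σ _ => (hc.conj σ).card_filter_le_one hI
  rw [h, Finset.sum_const, Finset.card_univ, smul_eq_mul, mul_one,
    card_perm_eq_card_matchingPerms_mul hn hM₀] at h1
  exact Nat.le_of_mul_le_mul_right h1 stabilizer_card_pos

/-- An intersecting family attaining the clique-coclique bound meets every one-factorization. -/
theorem IsOneFactorization.exists_mem {ι : Type} [Fintype ι] {c : ι → Equiv.Perm V}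
    (hc : IsOneFactorization c) {n : ℕ} (hn : Fintype.card V = 2 * n) {M₀ : Equiv.Perm V}
    (hM₀ : IsMatchingPerm M₀) {F : Finset (Equiv.Perm V)} (hF : F ⊆ matchingPerms V)
    (hI : IsIntersectingPerms F)
    (heq : Fintype.card ι * F.card = (matchingPerms V).card) : ∃ i, c i ∈ F := by
  have h := sum_conj_fiber hn hM₀ hc.matching hF
  have h1 : ∑ σ : Equiv.Perm V, (Finset.univ.filter fun i => σ * c i * σ⁻¹ ∈ F).card =
      ∑ σ : Equiv.Perm V, 1 := by
    rw [h, heq, Finset.sum_const, Finset.card_univ, smul_eq_mul, mul_one,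
      card_perm_eq_card_matchingPerms_mul hn hM₀]
  rw [Finset.sum_eq_sum_iff_of_le fun σ _ => (hc.conj σ).card_filter_le_one hI] at h1
  -- Equality forces every conjugate of `c` to meet F exactly once; σ = 1 gives `c` itself.
  have h2 := h1 1 (Finset.mem_univ _)
  obtain ⟨i, hi⟩ := Finset.card_pos.1 (h2 ▸ Nat.one_pos)
  exact ⟨i, by simpa using hi⟩

/-- The number of perfect matchings through a given edge. -/
theorem card_filter_apply_eq {n : ℕ} (hpos : 1 ≤ n) (hn : Fintype.card V = 2 * n)
    {M₀ : Equiv.Perm V} (hM₀ : IsMatchingPerm M₀) {x y : V} (hxy : x ≠ y) :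
    ((matchingPerms V).filter fun M => M x = y).card = (2 * (n - 1) - 1)‼ := by
  have hall : ∀ z ∈ Finset.univ.erase x,
      ((matchingPerms V).filter fun M => M x = z).card =
        ((matchingPerms V).filter fun M => M x = y).card := by
    intro z hz
    have hzx : z ≠ x := Finset.ne_of_mem_erase hz
    -- Conjugation by the transposition of y and z fixes x, so all 2n-1 possible partners of x are
    -- equally frequent.
    refine Finset.card_equiv (MulAut.conj (Equiv.swap y z)).toEquiv fun M => ?_
    have hx : Equiv.swap y z x = x := Equiv.swap_apply_of_ne_of_ne hxy hzx.symm
    simp only [Finset.mem_filter, mem_matchingPerms, MulEquiv.toEquiv_eq_coe, MulEquiv.coe_toEquiv,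
      MulAut.conj_apply]
    refine and_congr ⟨fun h => h.conj _, fun h => ?_⟩ ?_
    · have := h.conj (Equiv.swap y z)⁻¹
      simpa [mul_assoc] using this
    · rw [Equiv.swap_inv, Equiv.Perm.mul_apply, Equiv.Perm.mul_apply, hx,
        Equiv.swap_apply_eq_iff, Equiv.swap_apply_left]
  have hsum : (matchingPerms V).card =
      ∑ z ∈ Finset.univ.erase x, ((matchingPerms V).filter fun M => M x = z).card :=
    Finset.card_eq_sum_card_fiberwise fun M hM => by
      simpa using ((mem_matchingPerms.1 hM) x).1
  rw [Finset.sum_congr rfl hall, Finset.sum_const, Finset.card_erase_of_mem (Finset.mem_univ _),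
    Finset.card_univ, hn, card_matchingPerms_eq_doubleFactorial hpos hn hM₀, smul_eq_mul] at hsum
  exact (Nat.eq_of_mul_eq_mul_left (by omega) hsum).symm

end

/-! ### One-factorizations from Latin squares -/

section

variable {W : Type} [Fintype W] [DecidableEq W]

/-- A Latin rectangle, as the set of its rows: permutations no two of which agree anywhere. -/
def IsLatinSet {W : Type} (T : Finset (Equiv.Perm W)) : Prop :=
  ∀ σ ∈ T, ∀ τ ∈ T, ∀ x, σ x = τ x → σ = τ

/-- A Latin rectangle that is not a square can be extended by a row. -/
theorem IsLatinSet.exists_disjoint {T : Finset (Equiv.Perm W)} (hT : IsLatinSet T)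
    (hcard : T.card < Fintype.card W) : ∃ ρ : Equiv.Perm W, ∀ σ ∈ T, ∀ x, σ x ≠ ρ x := by
  classical
  let r : W → W → Prop := fun x y => ∀ σ ∈ T, σ x ≠ y
  have hrow : ∀ x, (Finset.univ.filter (r x)).card = Fintype.card W - T.card := by
    intro x
    have : Finset.univ.filter (r x) = (T.image fun σ => σ x)ᶜ := by
      ext y; simp [r]
    rw [this, Finset.card_compl, Finset.card_image_of_injOn]
    intro σ hσ τ hτ h
    exact hT σ hσ τ hτ x h
  have hcol : ∀ y, (Finset.univ.filter fun x => r x y).card = Fintype.card W - T.card := by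
    intro y
    have : (Finset.univ.filter fun x => r x y) = (T.image fun σ => σ.symm y)ᶜ := by
      ext x
      simp only [r, Finset.mem_filter, Finset.mem_univ, true_and, Finset.mem_compl,
        Finset.mem_image, not_exists, not_and, Equiv.symm_apply_eq]
      exact forall₂_congr fun σ _ => not_congr eq_comm
    rw [this, Finset.card_compl, Finset.card_image_of_injOn]
    intro σ hσ τ hτ h
    have h' : σ.symm y = τ.symm y := h
    refine hT σ hσ τ hτ (σ.symm y) ?_
    conv_rhs => rw [h']
    simp
  -- The relation "symbol y is still free in column x" is regular of positive degree on both sides,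
  -- so double counting gives Hall's condition.
  have hall := (Fintype.all_card_le_filter_rel_iff_exists_injective r).1 (by
    intro A
    have hd : 0 < Fintype.card W - T.card := by omega
    refine Nat.le_of_mul_le_mul_right ?_ hd
    have := Finset.card_mul_le_card_mul (s := A)
      (t := Finset.univ.filter fun b => ∃ a ∈ A, r a b) r
      (m := Fintype.card W - T.card) (n := Fintype.card W - T.card) ?_ ?_
    · exact this
    · intro a ha
      rw [← hrow a]
      refine Finset.card_le_card fun y hy => ?_
      simp only [Finset.mem_filter, Finset.mem_univ, true_and] at hy
      simp only [Finset.mem_bipartiteAbove, Finset.mem_filter, Finset.mem_univ, true_and]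
      exact ⟨⟨a, ha, hy⟩, hy⟩
    · intro b _
      rw [← hcol b]
      refine Finset.card_le_card fun y hy => ?_
      simp only [Finset.mem_bipartiteBelow] at hy
      simpa using hy.2)
  obtain ⟨f, hf, hr⟩ := hall
  exact ⟨Equiv.ofBijective f (Finite.injective_iff_bijective.1 hf), fun σ hσ x => hr x σ hσ⟩

/-- Every Latin rectangle extends to a Latin square. -/
theorem IsLatinSet.exists_superset [Nonempty W] {T : Finset (Equiv.Perm W)} (hT : IsLatinSet T)
    (hcard : T.card ≤ Fintype.card W) :
    ∃ S, T ⊆ S ∧ IsLatinSet S ∧ S.card = Fintype.card W := by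
  induction hk : Fintype.card W - T.card generalizing T with
  | zero => exact ⟨T, le_refl _, hT, by omega⟩
  | succ k ih =>
    obtain ⟨ρ, hρ⟩ := hT.exists_disjoint (by omega)
    have hmem : ρ ∉ T := fun h => hρ ρ h (Classical.arbitrary W) rfl
    have hc := Finset.card_insert_of_notMem hmem
    obtain ⟨S, hS, hL, hC⟩ := ih (T := insert ρ T) (by
      intro σ hσ τ hτ x h
      rw [Finset.mem_insert] at hσ hτ
      rcases hσ with rfl | hσ <;> rcases hτ with rfl | hτ
      · rfl
      · exact absurd h.symm (hρ τ hτ x)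
      · exact absurd h (hρ σ hσ x)
      · exact hT σ hσ τ hτ x h) (by omega) (by omega)
    exact ⟨S, (Finset.subset_insert _ _).trans hS, hL, hC⟩

/-- The perfect matching of two copies of `W` that joins each `x` on the left with `τ x` on the
right. -/
def crossMatching (τ : Equiv.Perm W) : Equiv.Perm (W ⊕ W) :=
  Function.Involutive.toPerm (Sum.elim (fun x => Sum.inr (τ x)) fun y => Sum.inl (τ.symm y)) (by
    rintro (x | y) <;> simp)

/-- The perfect matching of two copies of `W`, identified by `ρ`, induced by an involution `d`
of `W`: non-fixed points are matched by `d` within each copy, the two copies of a fixed point are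
matched with each other. -/
def foldedMatching (ρ d : Equiv.Perm W) (hd : Function.Involutive d) : Equiv.Perm (W ⊕ W) :=
  Function.Involutive.toPerm
    (Sum.elim (fun x => if d x = x then Sum.inr (ρ x) else Sum.inl (d x))
      fun y => if d (ρ.symm y) = ρ.symm y then Sum.inl (ρ.symm y) else Sum.inr (ρ (d (ρ.symm y)))) (by
    rintro (x | y)
    · by_cases h : d x = x
      · simp [h]
      · simp [h, hd x, Ne.symm h]
    · by_cases h : d (ρ.symm y) = ρ.symm y
      · simp [h]
      · simp [h, hd (ρ.symm y), Ne.symm h])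

theorem crossMatching_inl {W : Type} (τ : Equiv.Perm W) (x : W) :
    crossMatching τ (Sum.inl x) = Sum.inr (τ x) := rfl

theorem crossMatching_inr {W : Type} (τ : Equiv.Perm W) (y : W) :
    crossMatching τ (Sum.inr y) = Sum.inl (τ.symm y) := rfl

theorem foldedMatching_inl {W : Type} [DecidableEq W] (ρ d : Equiv.Perm W)
    (hd : Function.Involutive d) (x : W) : foldedMatching ρ d hd (Sum.inl x) =
      if d x = x then Sum.inr (ρ x) else Sum.inl (d x) := rfl

theorem foldedMatching_inr {W : Type} [DecidableEq W] (ρ d : Equiv.Perm W)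
    (hd : Function.Involutive d) (y : W) : foldedMatching ρ d hd (Sum.inr y) =
      if d (ρ.symm y) = ρ.symm y then Sum.inl (ρ.symm y) else Sum.inr (ρ (d (ρ.symm y))) := rfl

theorem isMatchingPerm_crossMatching {W : Type} (τ : Equiv.Perm W) :
    IsMatchingPerm (crossMatching τ) := by
  refine fun x => ⟨?_, Function.Involutive.toPerm_involutive _ x⟩
  rcases x with x | y <;> simp [crossMatching_inl, crossMatching_inr]

theorem isMatchingPerm_foldedMatching {W : Type} [DecidableEq W] (ρ d : Equiv.Perm W)
    (hd : Function.Involutive d) : IsMatchingPerm (foldedMatching ρ d hd) := by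
  refine fun x => ⟨?_, Function.Involutive.toPerm_involutive _ x⟩
  rcases x with x | y
  · rw [foldedMatching_inl]
    split_ifs with h
    · simp
    · simpa using h
  · rw [foldedMatching_inr]
    split_ifs with h
    · simp
    · intro h'
      exact h (ρ.eq_symm_apply.2 (Sum.inr_injective h'))

theorem foldedMatching_ne_crossMatching {W : Type} [DecidableEq W] {ρ d τ : Equiv.Perm W}
    (hd : Function.Involutive d) (h : ∀ x, ρ x ≠ τ x) (z : W ⊕ W) :
    foldedMatching ρ d hd z ≠ crossMatching τ z := by
  rcases z with x | y
  · rw [foldedMatching_inl, crossMatching_inl]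
    split_ifs
    · simpa using h x
    · simp
  · rw [foldedMatching_inr, crossMatching_inr]
    split_ifs
    · intro h'
      apply h (ρ.symm y)
      conv_rhs => rw [Sum.inl_injective h']
      simp
    · simp

/-- A Latin square of order `|W|` with a distinguished row, together with the symmetric Latin
square `x + y` of an abelian group `W`, gives a one-factorization on two copies of `W`. -/
theorem exists_isOneFactorization_sum [AddCommGroup W] {T : Finset (Equiv.Perm W)}
    (hT : IsLatinSet T) (hcard : T.card = Fintype.card W) {ρ : Equiv.Perm W} (hρ : ρ ∈ T) :
    ∃ c : W ⊕ {τ // τ ∈ T.erase ρ} → Equiv.Perm (W ⊕ W), IsOneFactorization c ∧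
      ∀ τ, c (Sum.inr τ) = crossMatching τ.1 := by
  -- The folded factor for i pairs x with i - x in each copy; the edge joining x to its copy under ρ
  -- occurs exactly for i = x + x. These factors use up all edges inside the copies and the cross
  -- edges of the row ρ.
  have hinv : ∀ i : W, Function.Involutive (Equiv.subLeft i) := fun i x => by simp
  have key : ∀ τ ∈ T.erase ρ, ∀ x, ρ x ≠ τ x := fun τ hτ x h =>
    (Finset.ne_of_mem_erase hτ) (hT _ hρ _ (Finset.mem_of_mem_erase hτ) x h).symm
  have hlatin : ∀ i j x : W, i - x = j - x → i = j := fun i j x h => sub_left_injective h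
  refine ⟨Sum.elim (fun i => foldedMatching ρ (Equiv.subLeft i) (hinv i))
    fun τ => crossMatching τ.1, ⟨?_, ?_, ?_⟩, fun τ => rfl⟩
  · rintro (i | τ)
    · exact isMatchingPerm_foldedMatching _ _ (hinv i)
    · exact isMatchingPerm_crossMatching _
  · rintro (i | σ) (j | τ) z h
    · rcases z with x | y
      · simp only [Sum.elim_inl, foldedMatching_inl, Equiv.subLeft_apply] at h
        split_ifs at h with h1 h2 h2
        · rw [hlatin i j x (h1.trans h2.symm)]
        · rw [hlatin i j x (Sum.inl_injective h)]
      · simp only [Sum.elim_inl, foldedMatching_inr, Equiv.subLeft_apply] at h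
        split_ifs at h with h1 h2 h2
        · rw [hlatin i j _ (h1.trans h2.symm)]
        · rw [hlatin i j _ (ρ.injective (Sum.inr_injective h))]
    · exact absurd h (foldedMatching_ne_crossMatching (hinv i) (key _ τ.2) z)
    · exact absurd h.symm (foldedMatching_ne_crossMatching (hinv j) (key _ σ.2) z)
    · have hx : ∃ x, σ.1 x = τ.1 x := by
        rcases z with x | y
        · exact ⟨x, Sum.inr_injective h⟩
        · refine ⟨σ.1.symm y, ?_⟩
          have h' : σ.1.symm y = τ.1.symm y := Sum.inl_injective h
          conv_rhs => rw [h']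
          simp
      obtain ⟨x, hx⟩ := hx
      rw [Subtype.ext (hT _ (Finset.mem_of_mem_erase σ.2) _ (Finset.mem_of_mem_erase τ.2) x hx)]
  · have : 0 < Fintype.card W := Fintype.card_pos
    rw [Fintype.card_sum, Fintype.card_sum, Fintype.card_coe, Finset.card_erase_of_mem hρ, hcard]
    omega

theorem IsOneFactorization.permCongr {U V ι : Type} [Fintype U] [Fintype V] [Fintype ι]
    {c : ι → Equiv.Perm U} (hc : IsOneFactorization c) (e : U ≃ V) :
    IsOneFactorization fun i => e.permCongr (c i) where
  matching i x := by
    have h := hc.matching i (e.symm x)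
    refine ⟨fun h' => h.1 ?_, by simp [h.2]⟩
    rw [Equiv.eq_symm_apply]; simpa using h'
  disjoint i j x h := hc.disjoint i j (e.symm x) (by simpa using h)
  card := by rw [hc.card, Fintype.card_congr e]

theorem exists_isOneFactorization {V : Type} [Fintype V] {n : ℕ} (hpos : 1 ≤ n)
    (hn : Fintype.card V = 2 * n) :
    ∃ (ι : Type) (_ : Fintype ι) (c : ι → Equiv.Perm V), IsOneFactorization c := by
  have : NeZero n := ⟨by omega⟩
  obtain ⟨T, h1, hT, hcard⟩ := IsLatinSet.exists_superset (W := ZMod n) (T := {1})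
    (by intro σ hσ τ hτ x _; simp_all) (by simp [ZMod.card]; omega)
  obtain ⟨c, hc, -⟩ := exists_isOneFactorization_sum hT hcard (h1 (Finset.mem_singleton_self _))
  have e : ZMod n ⊕ ZMod n ≃ V := Fintype.equivOfCardEq (by simp [ZMod.card, hn]; omega)
  exact ⟨_, _, _, hc.permCongr e⟩

/-- A fixed-point-free permutation with a transposition among its cycles. -/
theorem exists_derangement_with_two_cycle {W : Type} [Fintype W] (h4 : 4 ≤ Fintype.card W) :
    ∃ (π : Equiv.Perm W) (a b : W), a ≠ b ∧ π a = b ∧ π b = a ∧ ∀ x, π x ≠ x := by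
  obtain ⟨m, hm⟩ : ∃ m, Fintype.card W = 2 + (m + 2) := ⟨Fintype.card W - 4, by omega⟩
  have e : Fin 2 ⊕ Fin (m + 2) ≃ W := Fintype.equivOfCardEq (by simp [hm])
  -- A rotation of at least two points has no fixed point, hence the requirement of two points
  -- besides the transposed pair.
  refine ⟨e.permCongr (Equiv.sumCongr (finRotate 2) (finRotate (m + 2))), e (Sum.inl 0),
    e (Sum.inl 1), by simp, by simp, by simp, fun x => ?_⟩
  obtain ⟨z, rfl⟩ := e.surjective x
  simp only [Equiv.permCongr_apply, Equiv.symm_apply_apply, ne_eq, EmbeddingLike.apply_eq_iff_eq]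
  rcases z with z | z
  · fin_cases z <;> simp
  · simp

/-- For at least eight vertices there is a one-factorization two of whose factors have
a 4-cycle in their union. -/
theorem exists_isOneFactorization_with_four_cycle {V : Type} [Fintype V] {n : ℕ} (h4 : 4 ≤ n)
    (hn : Fintype.card V = 2 * n) :
    ∃ (ι : Type) (_ : Fintype ι) (c : ι → Equiv.Perm V) (i j : ι) (p q : V),
      IsOneFactorization c ∧ i ≠ j ∧ p ≠ q ∧ c i p ≠ q ∧ c j p = c i q ∧ c j q = c i p := by
  classical
  have : NeZero n := ⟨by omega⟩
  obtain ⟨π, a, b, hab, hπa, hπb, hπ⟩ := exists_derangement_with_two_cycle (W := ZMod n)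
    (by simpa [ZMod.card])
  have h1π : (1 : Equiv.Perm (ZMod n)) ≠ π := fun h => hπ 0 (by simp [← h])
  obtain ⟨T, hsub, hT, hcard⟩ := IsLatinSet.exists_superset (W := ZMod n) (T := {1, π})
    (by
      intro σ hσ τ hτ x h
      simp only [Finset.mem_insert, Finset.mem_singleton] at hσ hτ
      rcases hσ with rfl | rfl <;> rcases hτ with rfl | rfl
      · rfl
      · exact absurd h.symm (hπ x)
      · exact absurd h (hπ x)
      · rfl)
    (by rw [Finset.card_pair h1π, ZMod.card]; omega)
  -- A third row is spent on the folded factors, so 1 and π survive as cross factors. The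
  -- transposition of a and b in π makes a 4-cycle in their union on the two copies of a and b.
  obtain ⟨ρ, hρ, hρ'⟩ : ∃ ρ ∈ T, ρ ∉ ({1, π} : Finset (Equiv.Perm (ZMod n))) := by
    refine Finset.exists_mem_notMem_of_card_lt_card ?_
    rw [Finset.card_pair h1π, hcard, ZMod.card]; omega
  simp only [Finset.mem_insert, Finset.mem_singleton, not_or] at hρ'
  obtain ⟨c, hc, hcross⟩ := exists_isOneFactorization_sum hT hcard hρ
  have e : ZMod n ⊕ ZMod n ≃ V := Fintype.equivOfCardEq (by simp [ZMod.card, hn]; omega)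
  refine ⟨_, _, _, Sum.inr ⟨1, Finset.mem_erase.2 ⟨Ne.symm hρ'.1, hsub (by simp)⟩⟩,
    Sum.inr ⟨π, Finset.mem_erase.2 ⟨Ne.symm hρ'.2, hsub (by simp)⟩⟩, e (Sum.inl a), e (Sum.inl b),
    hc.permCongr e, ?_, ?_, ?_, ?_, ?_⟩
  · simpa using h1π
  · simpa using hab
  · simp [hcross, crossMatching]
  · simp [hcross, crossMatching_inl, hπa]
  · simp [hcross, crossMatching_inl, hπb]

end

/-! ### Exchanging two vertices: connectivity and switching -/

section

variable {V : Type} [DecidableEq V]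

/-- The matching obtained by exchanging the roles of the vertices `x` and `y`. -/
def swapConj (x y : V) (M : Equiv.Perm V) : Equiv.Perm V :=
  Equiv.swap x y * M * (Equiv.swap x y)⁻¹

theorem IsMatchingPerm.conj_swap {M : Equiv.Perm V} (hM : IsMatchingPerm M) (x y : V) :
    IsMatchingPerm (swapConj x y M) :=
  hM.conj _

theorem swapConj_apply (x y : V) (M : Equiv.Perm V) (z : V) :
    swapConj x y M z = Equiv.swap x y (M (Equiv.swap x y z)) := by
  simp [swapConj]

theorem swapConj_apply_left (x y : V) (M : Equiv.Perm V) :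
    swapConj x y M x = Equiv.swap x y (M y) := by
  simp [swapConj]

theorem swapConj_apply_right (x y : V) (M : Equiv.Perm V) :
    swapConj x y M y = Equiv.swap x y (M x) := by
  simp [swapConj]

theorem swapConj_apply_of_ne {x y z : V} (M : Equiv.Perm V) (h1 : z ≠ x) (h2 : z ≠ y)
    (h3 : M z ≠ x) (h4 : M z ≠ y) : swapConj x y M z = M z := by
  rw [swapConj_apply, Equiv.swap_apply_of_ne_of_ne h1 h2, Equiv.swap_apply_of_ne_of_ne h3 h4]

theorem swapConj_apply_of_apply_eq {x y z : V} {M : Equiv.Perm V} (h1 : z ≠ x) (h2 : z ≠ y)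
    (h3 : M z = x) : swapConj x y M z = y := by
  rw [swapConj_apply, Equiv.swap_apply_of_ne_of_ne h1 h2, h3, Equiv.swap_apply_left]

theorem swapConj_swapConj (x y : V) (M : Equiv.Perm V) : swapConj x y (swapConj x y M) = M := by
  ext z; simp [swapConj]

theorem swapConj_comm (x y : V) (M : Equiv.Perm V) : swapConj x y M = swapConj y x M := by
  rw [swapConj, Equiv.swap_comm, swapConj]

theorem swapConj_eq_self {x y : V} {M : Equiv.Perm V} (hM : IsMatchingPerm M) (h : M x = y) :
    swapConj x y M = M := by
  have h' := hM.apply_eq_iff.1 h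
  ext z
  by_cases h1 : z = x
  · subst h1; rw [swapConj_apply_left, h', Equiv.swap_apply_left, h]
  by_cases h2 : z = y
  · subst h2; rw [swapConj_apply_right, h, Equiv.swap_apply_right, h']
  refine swapConj_apply_of_ne M h1 h2 (fun h3 => h2 ?_) fun h3 => h1 ?_
  · rw [← h, ← h3, (hM z).2]
  · exact M.injective (h3.trans h.symm)

/-- The centralizer of a matching moves any vertex to any other one, fixing the vertices
off the two edges concerned. -/
theorem IsMatchingPerm.exists_commute {N : Equiv.Perm V} (hN : IsMatchingPerm N) (u v : V) :
    ∃ π : Equiv.Perm V, π * N * π⁻¹ = N ∧ π u = v ∧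
      ∀ z, z ≠ u → z ≠ N u → z ≠ v → z ≠ N v → π z = z := by
  by_cases h1 : u = v
  · exact ⟨1, by simp, by simpa using h1, by simp⟩
  by_cases h2 : N u = v
  · exact ⟨Equiv.swap u v, swapConj_eq_self hN h2, by simp,
      fun z ha _ hc _ => Equiv.swap_apply_of_ne_of_ne ha hc⟩
  have h3 : N v ≠ u := fun h => h2 (hN.apply_eq_iff.1 h)
  have hu := (hN u).1
  have hv := (hN v).1
  -- The edges at u and v are disjoint here; interchanging them with u going to v preserves N.
  refine ⟨Equiv.swap u v * Equiv.swap (N u) (N v), ?_, ?_, ?_⟩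
  · rw [mul_inv_eq_iff_eq_mul]
    ext z
    have key : ∀ z, Equiv.swap (N u) (N v) (N z) = N (Equiv.swap u v z) := fun z =>
      N.injective.swap_apply u v z
    have key' : ∀ z, Equiv.swap u v (N z) = N (Equiv.swap (N u) (N v) z) := fun z => by
      have := N.injective.swap_apply (N u) (N v) z
      rw [(hN u).2, (hN v).2] at this
      exact this
    have hcomm : ∀ z, Equiv.swap u v (Equiv.swap (N u) (N v) z) =
        Equiv.swap (N u) (N v) (Equiv.swap u v z) := fun z => by
      have := (Equiv.swap u v).injective.swap_apply (N u) (N v) z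
      rwa [Equiv.swap_apply_of_ne_of_ne hu h2, Equiv.swap_apply_of_ne_of_ne h3 hv,
        eq_comm] at this
    simp only [Equiv.Perm.mul_apply]
    rw [key, key', hcomm]
  · rw [Equiv.Perm.mul_apply, Equiv.swap_apply_of_ne_of_ne hu.symm h3.symm,
      Equiv.swap_apply_left]
  · intro z a b c d
    rw [Equiv.Perm.mul_apply, Equiv.swap_apply_of_ne_of_ne b d,
      Equiv.swap_apply_of_ne_of_ne a c]

variable [Fintype V]

/-- The vertices at which two matchings differ. -/
def disagreement (M N : Equiv.Perm V) : Finset V :=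
  Finset.univ.filter fun z => M z ≠ N z

/-- A connectivity principle: a matching `M` can be transformed into `N` by exchanging, one at
a time, the partners in `M` and in `N` of a vertex at which the two disagree. -/
theorem IsMatchingPerm.induction_swap {N : Equiv.Perm V} (hN : IsMatchingPerm N)
    {P : Equiv.Perm V → Prop}
    (step : ∀ M, IsMatchingPerm M → ∀ z, M z ≠ N z → P M → P (swapConj (M z) (N z) M))
    {M : Equiv.Perm V} (hM : IsMatchingPerm M) (h : P M) : P N := by
  -- The exchange makes z agree, and vertices already in agreement lie off the edges it alters.
  induction hk : (disagreement M N).card using Nat.strong_induction_on generalizing M with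
  | _ k ih =>
    by_cases hz : ∃ z, M z ≠ N z
    · obtain ⟨z, hz⟩ := hz
      refine ih _ ?_ (hM.conj_swap (M z) (N z)) (step M hM z hz h) rfl
      rw [← hk]
      have hz1 : z ≠ M z := fun h => (hM z).1 h.symm
      have hz2 : z ≠ N z := fun h => (hN z).1 h.symm
      have hagree : swapConj (M z) (N z) M z = N z :=
        swapConj_apply_of_apply_eq hz1 hz2 rfl
      refine Finset.card_lt_card (Finset.ssubset_iff_of_subset ?_ |>.2 ⟨z, ?_, ?_⟩)
      · intro w hw
        simp only [disagreement, Finset.mem_filter, Finset.mem_univ, true_and] at hw ⊢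
        intro hMN
        apply hw
        have hwz : w ≠ z := by rintro rfl; exact hz hMN
        rw [← hMN]
        refine swapConj_apply_of_ne M ?_ ?_ ?_ ?_
        · rintro rfl
          rw [(hM z).2, eq_comm, hN.apply_eq_iff] at hMN
          exact hz hMN.symm
        · rintro rfl
          rw [(hN z).2, hM.apply_eq_iff] at hMN
          exact hz hMN
        · exact fun h' => hwz (M.injective h')
        · exact fun h' => hwz (N.injective (hMN ▸ h'))
      · simpa [disagreement] using hz
      · simpa [disagreement] using hagree
    · push Not at hz
      rwa [← Equiv.ext hz]

/-- Exchanging the diagonals of a 4-cycle in the union of two factors of a one-factorization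
gives another one-factorization. -/
theorem IsOneFactorization.update_swapConj {ι : Type} [Fintype ι] [DecidableEq ι]
    {c : ι → Equiv.Perm V} (hc : IsOneFactorization c) {i j : ι} {p q : V}
    (h1 : c j p = c i q) (h2 : c j q = c i p) :
    IsOneFactorization (fun k => if k = i ∨ k = j then swapConj p q (c k) else c k) := by
  -- The two factors only trade opposite edges of the 4-cycle. Every new edge therefore comes from
  -- one of the old pair, which keeps the new factors disjoint from all others.
  have hswap : ∀ k, (k = i ∨ k = j) → ∀ x,
      swapConj p q (c k) x = c i x ∨ swapConj p q (c k) x = c j x := by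
    intro k hk x
    have hk' := hc.matching k
    have e1 := hc.matching i p
    have e2 := hc.matching i q
    have e3 := hc.matching j p
    have e4 := hc.matching j q
    by_cases hx1 : x = p
    · rw [hx1, swapConj_apply_left]
      rcases hk with rfl | rfl
      · right
        rw [h1]
        exact Equiv.swap_apply_of_ne_of_ne (h1 ▸ e3.1) e2.1
      · left
        rw [h2]
        exact Equiv.swap_apply_of_ne_of_ne e1.1 (h2 ▸ e4.1)
    by_cases hx2 : x = q
    · rw [hx2, swapConj_apply_right]
      rcases hk with rfl | rfl
      · right
        rw [h2]
        exact Equiv.swap_apply_of_ne_of_ne e1.1 (h2 ▸ e4.1)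
      · left
        rw [h1]
        exact Equiv.swap_apply_of_ne_of_ne (h1 ▸ e3.1) e2.1
    by_cases hx3 : c k x = p
    · rw [swapConj_apply_of_apply_eq hx1 hx2 hx3]
      rw [hk'.apply_eq_iff] at hx3
      rcases hk with rfl | rfl
      · right; rw [← hx3, ← h2, e4.2]
      · left; rw [← hx3, h1, e2.2]
    by_cases hx4 : c k x = q
    · rw [swapConj_comm, swapConj_apply_of_apply_eq hx2 hx1 hx4]
      rw [hk'.apply_eq_iff] at hx4
      rcases hk with rfl | rfl
      · right; rw [← hx4, ← h1, e3.2]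
      · left; rw [← hx4, h2, e1.2]
    rw [swapConj_apply_of_ne _ hx1 hx2 hx3 hx4]
    rcases hk with rfl | rfl <;> simp
  have aux : ∀ k l, (k = i ∨ k = j) → ¬ (l = i ∨ l = j) → ∀ x, swapConj p q (c k) x ≠ c l x := by
    intro k l hk hl x h
    rw [not_or] at hl
    rcases hswap k hk x with h' | h'
    · exact hl.1 (hc.disjoint l i x (by rw [← h, h']))
    · exact hl.2 (hc.disjoint l j x (by rw [← h, h']))
  refine ⟨fun k => ?_, fun k l x h => ?_, hc.card⟩
  · split_ifs
    · exact (hc.matching k).conj_swap p q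
    · exact hc.matching k
  · split_ifs at h with hk hl hl
    · rw [swapConj_apply, swapConj_apply, EmbeddingLike.apply_eq_iff_eq] at h
      exact hc.disjoint k l _ h
    · exact absurd h (aux k l hk hl x)
    · exact absurd h.symm (aux l k hl hk x)
    · exact hc.disjoint k l x h

end

/-! ### Rigidity of intersecting families that meet every one-factorization -/

section

variable {V : Type} [Fintype V] [DecidableEq V]

/-- An intersecting family of perfect matchings that meets every one-factorization. -/
structure IsTransversalFamily (F : Finset (Equiv.Perm V)) : Prop where
  matching : ∀ M ∈ F, IsMatchingPerm M
  intersecting : IsIntersectingPerms F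
  meets : ∀ (ι : Type) [Fintype ι] (c : ι → Equiv.Perm V), IsOneFactorization c → ∃ i, c i ∈ F

/-- Since `c i` is in F, no other factor is. The switched one-factorization must still meet F, and
it can do so only in the switched `c j`. -/
theorem IsTransversalFamily.exchange {F : Finset (Equiv.Perm V)} (hF : IsTransversalFamily F)
    {ι : Type} [Fintype ι] {c : ι → Equiv.Perm V} (hc : IsOneFactorization c) {i j : ι}
    (hij : i ≠ j) {p q : V} (h1 : c j p = c i q) (h2 : c j q = c i p) (hi : c i ∈ F)
    (hi' : swapConj p q (c i) ∉ F) : c j ∉ F ∧ swapConj p q (c j) ∈ F := by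
  classical
  have huniq : ∀ k, c k ∈ F → i = k := by
    intro k hk
    obtain ⟨x, hx⟩ := hF.intersecting _ hi _ hk
    exact hc.disjoint i k x hx
  refine ⟨fun h => hij (huniq j h), ?_⟩
  obtain ⟨k, hk⟩ := hF.meets ι _ (hc.update_swapConj h1 h2)
  split_ifs at hk with h
  · rcases h with rfl | rfl
    · exact absurd hk hi'
    · exact hk
  · exact absurd (Or.inl (huniq k hk).symm) h

/-- Switching is an involution, so this is `IsTransversalFamily.exchange` for the switched
one-factorization with i and j interchanged. -/
theorem IsTransversalFamily.exchange' {F : Finset (Equiv.Perm V)} (hF : IsTransversalFamily F)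
    {ι : Type} [Fintype ι] {c : ι → Equiv.Perm V} (hc : IsOneFactorization c) {i j : ι}
    (hij : i ≠ j) {p q : V} (h1 : c j p = c i q) (h2 : c j q = c i p) (hj : c j ∉ F)
    (hj' : swapConj p q (c j) ∈ F) : c i ∈ F ∧ swapConj p q (c i) ∉ F := by
  classical
  have h := hF.exchange (hc.update_swapConj h1 h2) (i := j) (j := i) hij.symm (p := p) (q := q)
  simp only [or_true, if_true, true_or, swapConj_swapConj, swapConj_apply_left,
    swapConj_apply_right] at h
  exact (h (by rw [h1]) (by rw [h2]) hj' hj).symm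

/-- Composing σ with an element of the centralizer of M corrects one image without disturbing those
on other edges; this lets images be prescribed one at a time. -/
theorem IsMatchingPerm.exists_conj_extend {V : Type} [DecidableEq V] {M₀ M σ : Equiv.Perm V} (hM : IsMatchingPerm M)
    (hσ : σ * M₀ * σ⁻¹ = M) (u v : V) :
    ∃ σ' : Equiv.Perm V, σ' * M₀ * σ'⁻¹ = M ∧ σ' u = v ∧
      ∀ s, s ≠ u → s ≠ M₀ u → σ s ≠ v → σ s ≠ M v → σ' s = σ s := by
  obtain ⟨π, h1, h2, h3⟩ := hM.exists_commute (σ u) v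
  refine ⟨π * σ, ?_, h2, fun s a b c d => h3 _ (by simpa using a) ?_ c d⟩
  · rw [mul_inv_rev, ← h1, ← hσ]; group
  · rw [← hσ]; simpa using b

/-- Four edges of one matching can be mapped to four prescribed edges of another one. -/
theorem IsMatchingPerm.exists_conj_four {n : ℕ} (hn : Fintype.card V = 2 * n)
    {M₀ M : Equiv.Perm V} (hM₀ : IsMatchingPerm M₀) (hM : IsMatchingPerm M)
    {u v : Fin 4 → V} (hu : ∀ i j, i < j → u i ≠ u j ∧ u i ≠ M₀ (u j))
    (hv : ∀ i j, i < j → v i ≠ v j ∧ v i ≠ M (v j)) :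
    ∃ σ : Equiv.Perm V, σ * M₀ * σ⁻¹ = M ∧ ∀ i, σ (u i) = v i := by
  have main : ∀ k : ℕ, k ≤ 4 → ∃ σ : Equiv.Perm V, σ * M₀ * σ⁻¹ = M ∧
      ∀ i : Fin 4, i.1 < k → σ (u i) = v i := by
    intro k
    induction k with
    | zero =>
      intro _
      obtain ⟨σ, hσ⟩ := hM₀.exists_conj hM hn
      exact ⟨σ, hσ, fun i hi => absurd hi (Nat.not_lt_zero _)⟩
    | succ k ih =>
      intro hk
      obtain ⟨σ, hσ, hi⟩ := ih (by omega)
      obtain ⟨σ', h1, h2, h3⟩ := hM.exists_conj_extend hσ (u ⟨k, by omega⟩) (v ⟨k, by omega⟩)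
      refine ⟨σ', h1, fun i hik => ?_⟩
      rcases Nat.lt_succ_iff_lt_or_eq.1 hik with hlt | rfl
      · have hlt' : i < (⟨k, by omega⟩ : Fin 4) := hlt
        rw [h3 _ (hu _ _ hlt').1 (hu _ _ hlt').2, hi i hlt]
        · rw [hi i hlt]; exact (hv _ _ hlt').1
        · rw [hi i hlt]; exact (hv _ _ hlt').2
      · exact h2
  obtain ⟨σ, h1, h2⟩ := main 4 le_rfl
  exact ⟨σ, h1, fun i => h2 i i.2⟩

theorem exists_notMem_list (l : List V) (h : l.length < Fintype.card V) : ∃ x, x ∉ l := by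
  by_contra! hall
  have : Finset.univ ⊆ l.toFinset := fun x _ => by simpa using hall x
  have := (Finset.card_le_card this).trans l.toFinset_card_le
  rw [Finset.card_univ] at this
  omega

/-- Every configuration of four edges of a matching occurs in a one-factorization in which
another factor closes two of the edges to a 4-cycle and joins the other two. -/
theorem exists_isOneFactorization_through {n : ℕ} (h4 : 4 ≤ n) (hn : Fintype.card V = 2 * n)
    {M : Equiv.Perm V} (hM : IsMatchingPerm M) {v : Fin 4 → V}
    (hv : ∀ i j, i < j → v i ≠ v j ∧ v i ≠ M (v j)) :
    ∃ (ι : Type) (_ : Fintype ι) (c : ι → Equiv.Perm V) (i j : ι), IsOneFactorization c ∧ i ≠ j ∧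
      c i = M ∧ c j (v 0) = M (v 1) ∧ c j (v 1) = M (v 0) ∧ c j (v 2) = v 3 := by
  obtain ⟨ι, _, c, i, j, p, q, hc, hij, hpq, hpq', h1, h2⟩ :=
    exists_isOneFactorization_with_four_cycle h4 hn
  -- The 4-cycle is closed under `c j`, so x and `c j x` both lie off it. Together with p and q they
  -- represent four distinct edges of `c i`.
  obtain ⟨x, hx⟩ := exists_notMem_list [p, q, c i p, c i q] (by simp; omega)
  simp only [List.mem_cons, List.not_mem_nil, or_false, not_or] at hx
  obtain ⟨x1, x2, x3, x4⟩ := hx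
  have hi := hc.matching i
  have hj := hc.matching j
  have hd : c i x ≠ c j x := fun h => hij (hc.disjoint i j x h)
  have y1 : c j x ≠ p := fun h => x4 (by rw [← h1, ← h, (hj x).2])
  have y2 : c j x ≠ q := fun h => x3 (by rw [← h2, ← h, (hj x).2])
  have y3 : c j x ≠ c i p := fun h => x2 ((c j).injective (by rw [h, h2]))
  have y4 : c j x ≠ c i q := fun h => x1 ((c j).injective (by rw [h, h1]))
  have inv : ∀ a b : V, a ≠ c i b → b ≠ c i a := fun a b h h' => h (by rw [h', (hi a).2])
  obtain ⟨σ, hσ, huv⟩ := hi.exists_conj_four hn hM (u := ![p, q, x, c j x]) (v := v) (by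
    intro a b hab
    fin_cases a <;> fin_cases b <;> first | exact absurd hab (by decide) | skip
    · exact ⟨hpq, inv _ _ (Ne.symm hpq')⟩
    · exact ⟨Ne.symm x1, inv _ _ x3⟩
    · exact ⟨y1.symm, inv _ _ y3⟩
    · exact ⟨Ne.symm x2, inv _ _ x4⟩
    · exact ⟨y2.symm, inv _ _ y4⟩
    · exact ⟨(hj x).1.symm, inv _ _ hd.symm⟩) hv
  have hMσ : ∀ z, M (σ z) = σ (c i z) := fun z => by rw [← hσ]; simp
  have e0 : σ p = v 0 := huv 0
  have e1 : σ q = v 1 := huv 1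
  have e2 : σ x = v 2 := huv 2
  have e3 : σ (c j x) = v 3 := huv 3
  refine ⟨ι, _, _, i, j, hc.conj σ, hij, hσ, ?_, ?_, ?_⟩
  · rw [← e0, ← e1, hMσ]; simp [h1]
  · rw [← e0, ← e1, hMσ]; simp [h2]
  · rw [← e2, ← e3]; simp

/-- Membership in `F`, and its loss on exchanging `p` and `q`, is unaffected by an exchange of two
vertices `x` and `y` elsewhere. -/
theorem IsTransversalFamily.swapConj_mem {F : Finset (Equiv.Perm V)} (hF : IsTransversalFamily F)
    {n : ℕ} (h4 : 4 ≤ n) (hn : Fintype.card V = 2 * n) {M : Equiv.Perm V} {p q x y : V}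
    (hpq : p ≠ q) (hpq' : M p ≠ q) (hxy : x ≠ y) (hxy' : M x ≠ y)
    (hx : x ∉ [p, q, M p, M q]) (hy : y ∉ [p, q, M p, M q])
    (hMF : M ∈ F) (hMF' : swapConj p q M ∉ F) :
    swapConj x y M ∈ F ∧ swapConj p q (swapConj x y M) ∉ F := by
  have hM := hF.matching M hMF
  simp only [List.mem_cons, List.not_mem_nil, or_false, not_or] at hx hy
  obtain ⟨x1, x2, x3, x4⟩ := hx
  obtain ⟨y1, y2, y3, y4⟩ := hy
  have inv : ∀ a b : V, a ≠ M b → b ≠ M a := fun a b h h' => h (by rw [h', (hM a).2])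
  obtain ⟨ι, _, c, i, j, hc, hij, hi, h1, h2, h3⟩ :=
    exists_isOneFactorization_through h4 hn hM (v := ![p, q, x, y]) (by
      intro a b hab
      fin_cases a <;> fin_cases b <;> first | exact absurd hab (by decide) | skip
      · exact ⟨hpq, inv _ _ (Ne.symm hpq')⟩
      · exact ⟨Ne.symm x1, inv _ _ x3⟩
      · exact ⟨Ne.symm y1, inv _ _ y3⟩
      · exact ⟨Ne.symm x2, inv _ _ x4⟩
      · exact ⟨Ne.symm y2, inv _ _ y4⟩
      · exact ⟨hxy, inv _ _ (Ne.symm hxy')⟩)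
  replace h1 : c j p = M q := h1
  replace h2 : c j q = M p := h2
  replace h3 : c j x = y := h3
  subst hi
  -- The loss at `c i` becomes a gain at `c j`. Since xy is an edge of `c j`, conjugating by the
  -- transposition of x and y fixes `c j`, and `exchange'` returns the information to the conjugate
  -- of `c i`.
  obtain ⟨hj, hj'⟩ := hF.exchange hc hij h1 h2 hMF hMF'
  have hjj : swapConj x y (c j) = c j := swapConj_eq_self (hc.matching j) h3
  have hp : swapConj x y (c i) p = c i p :=
    swapConj_apply_of_ne _ (Ne.symm x1) (Ne.symm y1) (Ne.symm x3) (Ne.symm y3)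
  have hq : swapConj x y (c i) q = c i q :=
    swapConj_apply_of_ne _ (Ne.symm x2) (Ne.symm y2) (Ne.symm x4) (Ne.symm y4)
  have hc' : IsOneFactorization fun k => swapConj x y (c k) := hc.conj (Equiv.swap x y)
  exact hF.exchange' hc' hij (p := p) (q := q) (by rw [hjj, h1, hq]) (by rw [hjj, h2, hp])
    (by rwa [hjj]) (by rwa [hjj])

/-- The path of exchanges from M to N never touches the edges at p and q, where the two agree. So
`IsTransversalFamily.swapConj_mem` applies at each step, provided the loss under exchanging p and q
is carried along with membership. -/
theorem IsTransversalFamily.mem_of_apply_eq {F : Finset (Equiv.Perm V)}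
    (hF : IsTransversalFamily F) {n : ℕ} (h4 : 4 ≤ n) (hn : Fintype.card V = 2 * n)
    {M N : Equiv.Perm V} {p q : V} (hpq : p ≠ q) (hpq' : M p ≠ q)
    (hMF : M ∈ F) (hMF' : swapConj p q M ∉ F) (hN : IsMatchingPerm N)
    (hNp : N p = M p) (hNq : N q = M q) : N ∈ F := by
  have key := hN.induction_swap
    (P := fun L => L p = M p ∧ L q = M q ∧ L ∈ F ∧ swapConj p q L ∉ F) ?_
    (hF.matching M hMF) ⟨rfl, rfl, hMF, hMF'⟩
  · exact key.2.2.1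
  rintro L hL z hz ⟨hLp, hLq, hLF, hLF'⟩
  have hagree : ∀ w, L w = N w → L z ≠ w ∧ N z ≠ w := by
    intro w hw
    refine ⟨fun h => hz ?_, fun h => hz ?_⟩
    · rw [hL.apply_eq_iff] at h
      rw [← h, (hL w).2, hw, (hN w).2]
    · rw [hN.apply_eq_iff] at h
      rw [← h, (hN w).2, ← hw, (hL w).2]
  have hp := hagree p (hLp.trans hNp.symm)
  have hq := hagree q (hLq.trans hNq.symm)
  have hp' := hagree (L p) (by rw [(hL p).2, hLp, ← hNp, (hN p).2])
  have hq' := hagree (L q) (by rw [(hL q).2, hLq, ← hNq, (hN q).2])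
  have hzz : L (L z) ≠ N z := by rw [(hL z).2]; exact (hN z).1.symm
  have := hF.swapConj_mem h4 hn (M := L) (p := p) (q := q) (x := L z) (y := N z) hpq
    (hLp ▸ hpq') hz hzz
    (by simp only [List.mem_cons, List.not_mem_nil, or_false, not_or]
        exact ⟨hp.1, hq.1, hp'.1, hq'.1⟩)
    (by simp only [List.mem_cons, List.not_mem_nil, or_false, not_or]
        exact ⟨hp.2, hq.2, hp'.2, hq'.2⟩) hLF hLF'
  refine ⟨?_, ?_, this⟩
  · rw [swapConj_apply_of_ne L hp.1.symm hp.2.symm hp'.1.symm hp'.2.symm, hLp]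
  · rw [swapConj_apply_of_ne L hq.1.symm hq.2.symm hq'.1.symm hq'.2.symm, hLq]

/-- Two edges extend to a perfect matching disjoint from a given one that avoids both. -/
theorem IsMatchingPerm.exists_disjoint {n : ℕ} (h4 : 4 ≤ n) (hn : Fintype.card V = 2 * n)
    {M N : Equiv.Perm V} (hM : IsMatchingPerm M) (hN : IsMatchingPerm N) {p q : V}
    (hp : N p ≠ M p) (hq : N q ≠ M q) :
    ∃ L, IsMatchingPerm L ∧ L p = M p ∧ L q = M q ∧ ∀ z, L z ≠ N z := by
  induction hk : (Finset.univ.filter fun z => M z = N z).card using Nat.strong_induction_on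
    generalizing M with
  | _ k ih =>
    by_cases hz : ∃ z, M z = N z
    swap
    · exact ⟨M, hM, rfl, rfl, fun z h => hz ⟨z, h⟩⟩
    obtain ⟨z, hz⟩ := hz
    -- Exchanging M z with such a y destroys the agreement at z, creates no new one and keeps the
    -- edges at p and q. Six excluded vertices are fewer than the eight available.
    obtain ⟨y, hy⟩ := exists_notMem_list [p, q, M p, M q, z, M z] (by simp; omega)
    simp only [List.mem_cons, List.not_mem_nil, or_false, not_or] at hy
    obtain ⟨y1, y2, y3, y4, y5, y6⟩ := hy
    have zz := hM z
    have nz := hN z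
    have hzp : z ≠ p := by rintro rfl; exact hp hz.symm
    have hzq : z ≠ q := by rintro rfl; exact hq hz.symm
    have hMzp : M z ≠ p := fun h => hp (by rw [← h, zz.2, hz, nz.2])
    have hMzq : M z ≠ q := fun h => hq (by rw [← h, zz.2, hz, nz.2])
    have hMp : M p ≠ M z := fun h => hzp (M.injective h).symm
    have hMq : M q ≠ M z := fun h => hzq (M.injective h).symm
    have ep : swapConj (M z) y M p = M p :=
      swapConj_apply_of_ne M hMzp.symm (Ne.symm y1) hMp (Ne.symm y3)
    have eq : swapConj (M z) y M q = M q :=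
      swapConj_apply_of_ne M hMzq.symm (Ne.symm y2) hMq (Ne.symm y4)
    have ez : swapConj (M z) y M z = y :=
      swapConj_apply_of_apply_eq zz.1.symm (Ne.symm y5) rfl
    have := ih _ ?_ (hM.conj_swap (M z) y) (by rwa [ep]) (by rwa [eq]) rfl
    · rwa [ep, eq] at this
    rw [← hk]
    refine Finset.card_lt_card (Finset.ssubset_iff_of_subset ?_ |>.2 ⟨z, ?_, ?_⟩)
    · intro w hw
      simp only [Finset.mem_filter, Finset.mem_univ, true_and] at hw ⊢
      by_cases h1 : w = M z
      · rw [h1, swapConj_apply_left, hz, nz.2, ← hz] at hw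
        rw [Equiv.swap_apply_eq_iff, Equiv.swap_apply_of_ne_of_ne zz.1.symm (Ne.symm y5)] at hw
        exact absurd (by rw [← hw, (hM y).2]) y6
      by_cases h2 : w = y
      · rw [h2, swapConj_apply_right, zz.2,
          Equiv.swap_apply_of_ne_of_ne zz.1.symm (Ne.symm y5), eq_comm, hN.apply_eq_iff] at hw
        exact absurd (by rw [hz, hw]) y6
      by_cases h3 : M w = M z
      · rw [M.injective h3, hz]
      by_cases h4 : M w = y
      · rw [swapConj_comm, swapConj_apply_of_apply_eq h2 h1 h4, hz] at hw
        rw [← N.injective hw, hz]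
      rwa [swapConj_apply_of_ne M h1 h2 h3 h4] at hw
    · simpa using hz
    · simp only [Finset.mem_filter, Finset.mem_univ, true_and, ez]
      rw [← hz]
      exact y6

/-- If N avoided both edges, some matching through both would be disjoint from N, yet it lies in F
by `IsTransversalFamily.mem_of_apply_eq`. -/
theorem IsTransversalFamily.apply_eq_or {F : Finset (Equiv.Perm V)}
    (hF : IsTransversalFamily F) {n : ℕ} (h4 : 4 ≤ n) (hn : Fintype.card V = 2 * n)
    {M : Equiv.Perm V} {p q : V} (hpq : p ≠ q) (hpq' : M p ≠ q)
    (hMF : M ∈ F) (hMF' : swapConj p q M ∉ F) {N : Equiv.Perm V} (hN : N ∈ F) :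
    N p = M p ∨ N q = M q := by
  by_contra! h
  obtain ⟨L, hL, hLp, hLq, hd⟩ :=
    (hF.matching M hMF).exists_disjoint h4 hn (hF.matching N hN) h.1 h.2
  obtain ⟨z, hz⟩ :=
    hF.intersecting L (hF.mem_of_apply_eq h4 hn hpq hpq' hMF hMF' hL hLp hLq) N hN
  exact hd z hz

/-- Otherwise connectivity would put every matching in F, including two disjoint factors. -/
theorem IsTransversalFamily.exists_swapConj_notMem {F : Finset (Equiv.Perm V)}
    (hF : IsTransversalFamily F) {n : ℕ} (h4 : 4 ≤ n) (hn : Fintype.card V = 2 * n) :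
    ∃ M ∈ F, ∃ p q, p ≠ q ∧ M p ≠ q ∧ swapConj p q M ∉ F := by
  by_contra! h
  obtain ⟨ι, _, c, i, j, p, q, hc, hij, -⟩ := exists_isOneFactorization_with_four_cycle h4 hn
  obtain ⟨k, hk⟩ := hF.meets ι c hc
  have hall : ∀ N, IsMatchingPerm N → N ∈ F := fun N hN =>
    hN.induction_swap (P := fun M => M ∈ F)
      (fun M hM z hz hMF => h M hMF _ _ hz (by rw [(hM z).2]; exact (hN z).1.symm))
      (hF.matching _ hk) hk
  obtain ⟨x, hx⟩ :=
    hF.intersecting _ (hall _ (hc.matching i)) _ (hall _ (hc.matching j))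
  exact hij (hc.disjoint i j x hx)

/-- On at least eight vertices, the members of a transversal family share an edge. -/
theorem IsTransversalFamily.exists_common_edge {F : Finset (Equiv.Perm V)}
    (hF : IsTransversalFamily F) {n : ℕ} (h4 : 4 ≤ n) (hn : Fintype.card V = 2 * n) :
    ∃ x y, x ≠ y ∧ ∀ M ∈ F, M x = y := by
  obtain ⟨M, hMF, p, q, hpq, hpq', hMF'⟩ := hF.exists_swapConj_notMem h4 hn
  have hM := hF.matching M hMF
  have hor := fun N (hN : N ∈ F) => hF.apply_eq_or h4 hn hpq hpq' hMF hMF' hN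
  by_cases h1 : ∀ N ∈ F, N p = M p
  · exact ⟨p, M p, (hM p).1.symm, h1⟩
  by_cases h2 : ∀ N ∈ F, N q = M q
  · exact ⟨q, M q, (hM q).1.symm, h2⟩
  push Not at h1 h2
  obtain ⟨N, hN, hNp⟩ := h1
  obtain ⟨L, hL, hLq⟩ := h2
  have hNq := (hor N hN).resolve_left hNp
  have hLp := (hor L hL).resolve_right hLq
  have hLm := hF.matching L hL
  have hLqp : L q ≠ p := fun h => hpq' (by rw [← hLp, ← h, (hLm q).2])
  -- L exchanged at p and q contains neither edge of the dichotomy for M. So L has its own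
  -- dichotomy, and N violates it.
  have hLF' : swapConj p q L ∉ F := by
    intro h
    rcases hor _ h with h' | h'
    · rw [swapConj_apply_left, Equiv.swap_apply_of_ne_of_ne hLqp (hLm q).1, ← hLp] at h'
      exact hpq (L.injective h').symm
    · rw [swapConj_apply_right, hLp, Equiv.swap_apply_of_ne_of_ne (hM p).1 hpq'] at h'
      exact hpq (M.injective h')
  rcases hF.apply_eq_or h4 hn hpq (hLp ▸ hpq') hL hLF' hN with h | h
  · exact absurd (h.trans hLp) hNp
  · exact absurd (h.symm.trans hNq) hLq

/-- On six vertices, the members of an intersecting family of three matchings share an edge. -/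
theorem exists_common_edge_of_card_six (hV : Fintype.card V = 6) {F : Finset (Equiv.Perm V)}
    (hF : ∀ M ∈ F, IsMatchingPerm M) (hI : IsIntersectingPerms F) (hcard : F.card = 3) :
    ∃ x y, x ≠ y ∧ ∀ M ∈ F, M x = y := by
  have hseven : ∀ l : List V, l.length = 7 → ¬ l.Nodup := fun l hl h => by
    have := h.length_le_card
    omega
  obtain ⟨M, N, L, hMN, hML, hNL, rfl⟩ := Finset.card_eq_three.1 hcard
  have hM := hF M (by simp)
  have hN := hF N (by simp)
  have hL := hF L (by simp)
  obtain ⟨a, ha⟩ := hI M (by simp) N (by simp)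
  by_cases hLa : L a = M a
  · exact ⟨a, M a, (hM a).1.symm, by simp [hLa, ha]⟩
  obtain ⟨c, hc⟩ := hI M (by simp) L (by simp)
  -- On six vertices two edges determine the third.
  have htwo : ∀ K, IsMatchingPerm K → ∀ u v, v ≠ u → v ≠ M u → K u = M u → K v = M v → M = K := by
    intro K hK u v hvu hvu' hu hv
    ext z
    by_contra hz
    refine hseven [u, v, M u, M v, z, M z, K z] rfl ?_
    have := hM u
    have := hM v
    have := hM z
    have := hK u
    have := hK v
    have := hK z
    simp only [List.nodup_cons, List.mem_cons, List.not_mem_nil, or_false, not_or,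
      List.nodup_nil, not_false_eq_true, and_true]
    clear hseven hI hF hcard
    split_ands <;> grind
  have hca : c ≠ a := by rintro rfl; exact hLa hc.symm
  have hca' : c ≠ M a := by
    rintro rfl
    rw [(hM a).2, eq_comm, hL.apply_eq_iff] at hc
    exact hLa hc
  have hNc : N c ≠ M c := fun h => hMN (htwo N hN a c hca hca' ha.symm h)
  obtain ⟨z, hz⟩ := hI N (by simp) L (by simp)
  -- Without a common edge, the three pairwise shared edges are disjoint and exhaust the six
  -- vertices, so N c would be a seventh.
  refine absurd ?_ (hseven [a, M a, c, M c, z, N z, N c] rfl)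
  have := hM a
  have := hM c
  have := hN a
  have := hN c
  have := hN z
  have := hL a
  have := hL c
  have := hL z
  simp only [List.nodup_cons, List.mem_cons, List.not_mem_nil, or_false, not_or,
    List.nodup_nil, not_false_eq_true, and_true]
  clear hseven hI hF hcard htwo hMN hML hNL
  split_ands <;> grind

end

/-! ### The extremal theorem for involutions -/

section

variable {V : Type} [Fintype V] [DecidableEq V]

theorem exists_isMatchingPerm {V : Type} [Fintype V] {n : ℕ} (hpos : 1 ≤ n) (hn : Fintype.card V = 2 * n) :
    ∃ M : Equiv.Perm V, IsMatchingPerm M := by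
  obtain ⟨ι, _, c, hc⟩ := exists_isOneFactorization hpos hn
  have hι : 0 < Fintype.card ι := by have := hc.card; omega
  obtain ⟨i⟩ := Fintype.card_pos_iff.1 hι
  exact ⟨c i, hc.matching i⟩

/-- An intersecting family of perfect matchings of `K_{2n}` has at most `(2n-3)!!` members. -/
theorem IsIntersectingPerms.card_le {n : ℕ} (hpos : 1 ≤ n) (hn : Fintype.card V = 2 * n)
    {F : Finset (Equiv.Perm V)} (hF : F ⊆ matchingPerms V) (hI : IsIntersectingPerms F) :
    F.card ≤ (2 * (n - 1) - 1)‼ := by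
  obtain ⟨ι, _, c, hc⟩ := exists_isOneFactorization hpos hn
  obtain ⟨M₀, hM₀⟩ := exists_isMatchingPerm hpos hn
  have h := hc.card_mul_le hn hM₀ hF hI
  have hι : Fintype.card ι = 2 * n - 1 := by have := hc.card; omega
  rw [card_matchingPerms_eq_doubleFactorial hpos hn hM₀, hι] at h
  exact Nat.le_of_mul_le_mul_left h (by omega)

/-- An intersecting family of `(2n-3)!!` perfect matchings of `K_{2n}` consists of all
perfect matchings through some edge. -/
theorem IsIntersectingPerms.eq_filter_of_card_eq {n : ℕ} (hpos : 1 ≤ n)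
    (hn : Fintype.card V = 2 * n) {F : Finset (Equiv.Perm V)} (hF : F ⊆ matchingPerms V)
    (hI : IsIntersectingPerms F) (hcard : F.card = (2 * (n - 1) - 1)‼) :
    ∃ x y, x ≠ y ∧ F = (matchingPerms V).filter fun M => M x = y := by
  obtain ⟨M₀, hM₀⟩ := exists_isMatchingPerm hpos hn
  have hm : ∀ M ∈ F, IsMatchingPerm M := fun M hM => mem_matchingPerms.1 (hF hM)
  suffices h : ∃ x y, x ≠ y ∧ ∀ M ∈ F, M x = y by
    obtain ⟨x, y, hxy, h⟩ := h
    refine ⟨x, y, hxy, Finset.eq_of_subset_of_card_le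
      (fun M hM => Finset.mem_filter.2 ⟨hF hM, h M hM⟩) ?_⟩
    rw [card_filter_apply_eq hpos hn hM₀ hxy, hcard]
  have hone : F.card = 1 → ∃ x y, x ≠ y ∧ ∀ M ∈ F, M x = y := by
    intro h
    obtain ⟨M, rfl⟩ := Finset.card_eq_one.1 h
    obtain ⟨x⟩ := Fintype.card_pos_iff.1 (show 0 < Fintype.card V by omega)
    exact ⟨x, M x, ((hm M (by simp)) x).1.symm, by simp⟩
  rcases Nat.lt_or_ge n 4 with hlt | h4
  · interval_cases n
    · exact hone hcard
    · exact hone hcard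
    · exact exists_common_edge_of_card_six hn hm hI hcard
  · have hT : IsTransversalFamily F := by
      refine ⟨hm, hI, fun ι _ c hc => hc.exists_mem hn hM₀ hF hI ?_⟩
      have hι : Fintype.card ι = 2 * n - 1 := by have := hc.card; omega
      rw [card_matchingPerms_eq_doubleFactorial hpos hn hM₀, hι, hcard]
    exact hT.exists_common_edge h4 hn

end

/-! ### Translation between perfect matching subgraphs and involutions -/

section

variable {n : ℕ}

/-- The involution exchanging the end points of each edge of a perfect matching. -/
noncomputable def PerfectMatching.toPerm (m : PerfectMatching n) : Equiv.Perm (Fin (2 * n)) :=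
  Function.Involutive.toPerm
    (fun v => (SimpleGraph.Subgraph.isPerfectMatching_iff.1 m.2 v).choose) fun v =>
      ((SimpleGraph.Subgraph.isPerfectMatching_iff.1 m.2 _).choose_spec.2 v
        (SimpleGraph.Subgraph.isPerfectMatching_iff.1 m.2 v).choose_spec.1.symm).symm

theorem PerfectMatching.adj_toPerm (m : PerfectMatching n) (x : Fin (2 * n)) :
    m.1.Adj x (m.toPerm x) :=
  (SimpleGraph.Subgraph.isPerfectMatching_iff.1 m.2 x).choose_spec.1

theorem PerfectMatching.toPerm_apply_eq_iff (m : PerfectMatching n) {x y : Fin (2 * n)} :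
    m.toPerm x = y ↔ m.1.Adj x y :=
  ⟨fun h => h ▸ m.adj_toPerm x, fun h =>
    ((SimpleGraph.Subgraph.isPerfectMatching_iff.1 m.2 x).choose_spec.2 y h).symm⟩

theorem PerfectMatching.isMatchingPerm_toPerm (m : PerfectMatching n) :
    IsMatchingPerm m.toPerm := fun x =>
  ⟨(m.adj_toPerm x).ne.symm, m.toPerm_apply_eq_iff.2 (m.adj_toPerm x).symm⟩

theorem PerfectMatching.toPerm_injective :
    Function.Injective (PerfectMatching.toPerm : PerfectMatching n → _) := by
  intro m m' h
  have hspan : ∀ k : PerfectMatching n, k.1.verts = Set.univ := fun k =>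
    Set.eq_univ_of_forall k.2.2
  refine Subtype.ext (SimpleGraph.Subgraph.ext ?_ ?_)
  · rw [hspan m, hspan m']
  · ext x y
    rw [← m.toPerm_apply_eq_iff, ← m'.toPerm_apply_eq_iff, h]

theorem PerfectMatching.exists_toPerm_eq {M : Equiv.Perm (Fin (2 * n))} (hM : IsMatchingPerm M) :
    ∃ m : PerfectMatching n, m.toPerm = M := by
  let G : (⊤ : SimpleGraph (Fin (2 * n))).Subgraph :=
    { verts := Set.univ
      Adj := fun x y => M x = y
      adj_sub := by rintro x _ rfl; exact (hM x).1.symm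
      edge_vert := fun _ => Set.mem_univ _
      symm := ⟨fun _ _ h => hM.apply_eq_iff.1 h⟩ }
  have hG : G.IsPerfectMatching :=
    SimpleGraph.Subgraph.isPerfectMatching_iff.2 fun v => ⟨M v, rfl, fun _ h => Eq.symm h⟩
  exact ⟨⟨G, hG⟩, Equiv.ext fun x => (PerfectMatching.toPerm_apply_eq_iff _).2 rfl⟩

theorem PerfectMatching.edgeSet_inter_nonempty_iff (m m' : PerfectMatching n) :
    (m.1.edgeSet ∩ m'.1.edgeSet).Nonempty ↔ ∃ x, m.toPerm x = m'.toPerm x := by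
  constructor
  · rintro ⟨e, h, h'⟩
    induction e with
    | _ x y =>
      rw [SimpleGraph.Subgraph.mem_edgeSet] at h h'
      exact ⟨x, (m.toPerm_apply_eq_iff.2 h).trans (m'.toPerm_apply_eq_iff.2 h').symm⟩
  · rintro ⟨x, hx⟩
    exact ⟨s(x, m.toPerm x), m.adj_toPerm x, m'.toPerm_apply_eq_iff.1 hx.symm⟩

/-- A family of perfect matchings, as a finite set of involutions. -/
noncomputable def familyPerms (F : Set (PerfectMatching n)) : Finset (Equiv.Perm (Fin (2 * n))) :=
  (Set.toFinite (PerfectMatching.toPerm '' F)).toFinset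

theorem mem_familyPerms {F : Set (PerfectMatching n)} {M : Equiv.Perm (Fin (2 * n))} :
    M ∈ familyPerms F ↔ ∃ m ∈ F, m.toPerm = M :=
  Set.Finite.mem_toFinset _

theorem toPerm_mem_familyPerms {F : Set (PerfectMatching n)} {m : PerfectMatching n} :
    m.toPerm ∈ familyPerms F ↔ m ∈ F := by
  rw [mem_familyPerms]
  exact ⟨fun ⟨_, h, h'⟩ => PerfectMatching.toPerm_injective h' ▸ h, fun h => ⟨m, h, rfl⟩⟩

theorem familyPerms_subset (F : Set (PerfectMatching n)) :
    familyPerms F ⊆ matchingPerms (Fin (2 * n)) := by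
  intro M hM
  obtain ⟨m, -, rfl⟩ := mem_familyPerms.1 hM
  exact mem_matchingPerms.2 m.isMatchingPerm_toPerm

theorem card_familyPerms (F : Set (PerfectMatching n)) : (familyPerms F).card = F.ncard := by
  rw [← Set.ncard_image_of_injective F PerfectMatching.toPerm_injective,
    Set.ncard_eq_toFinset_card _ (Set.toFinite _), familyPerms]

theorem IsIntersectingFamily.familyPerms {F : Set (PerfectMatching n)}
    (hF : IsIntersectingFamily F) : IsIntersectingPerms (familyPerms F) := by
  intro M hM N hN
  obtain ⟨m, hm, rfl⟩ := mem_familyPerms.1 hM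
  obtain ⟨m', hm', rfl⟩ := mem_familyPerms.1 hN
  exact (m.edgeSet_inter_nonempty_iff m').1 (hF m hm m' hm')

theorem mem_edgeFamily_iff {i j : Fin (2 * n)} {m : PerfectMatching n} :
    m ∈ edgeFamily i j ↔ m.toPerm i = j := by
  rw [m.toPerm_apply_eq_iff]
  rfl

theorem isIntersectingFamily_edgeFamily (i j : Fin (2 * n)) :
    IsIntersectingFamily (edgeFamily i j : Set (PerfectMatching n)) :=
  fun _ hm _ hm' => ⟨s(i, j), hm, hm'⟩

theorem ncard_edgeFamily (hn : 1 ≤ n) {i j : Fin (2 * n)} (hij : i ≠ j) :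
    (edgeFamily i j : Set (PerfectMatching n)).ncard = (2 * (n - 1) - 1)‼ := by
  have hV : Fintype.card (Fin (2 * n)) = 2 * n := Fintype.card_fin _
  obtain ⟨M₀, hM₀⟩ := exists_isMatchingPerm hn hV
  rw [← card_familyPerms, ← card_filter_apply_eq hn hV hM₀ hij]
  refine congrArg Finset.card (Finset.ext fun M => ?_)
  rw [Finset.mem_filter, mem_matchingPerms]
  constructor
  · intro h
    obtain ⟨m, hm, rfl⟩ := mem_familyPerms.1 h
    exact ⟨m.isMatchingPerm_toPerm, mem_edgeFamily_iff.1 hm⟩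
  · rintro ⟨hM, h⟩
    obtain ⟨m, rfl⟩ := PerfectMatching.exists_toPerm_eq hM
    exact toPerm_mem_familyPerms.2 (mem_edgeFamily_iff.2 h)

theorem IsIntersectingFamily.ncard_le (hn : 1 ≤ n) {F : Set (PerfectMatching n)}
    (hF : IsIntersectingFamily F) : F.ncard ≤ (2 * (n - 1) - 1)‼ := by
  rw [← card_familyPerms]
  exact hF.familyPerms.card_le hn (Fintype.card_fin _) (familyPerms_subset F)

theorem IsIntersectingFamily.isTriviallyIntersecting (hn : 1 ≤ n) {F : Set (PerfectMatching n)}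
    (hF : IsIntersectingFamily F) (hcard : F.ncard = (2 * (n - 1) - 1)‼) :
    IsTriviallyIntersecting F := by
  rw [← card_familyPerms] at hcard
  obtain ⟨i, j, hij, h⟩ := hF.familyPerms.eq_filter_of_card_eq hn (Fintype.card_fin _)
    (familyPerms_subset F) hcard
  refine ⟨i, j, hij, Set.ext fun m => ?_⟩
  rw [← toPerm_mem_familyPerms, h, mem_edgeFamily_iff]
  simp [m.isMatchingPerm_toPerm]

end

theorem mainTheorem2 (n : ℕ) (hn : 1 ≤ n) :
    (∀ F : Set (PerfectMatching n),
      IsMaximumIntersectingFamily F → IsTriviallyIntersecting F) ∧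
    (∀ F : Set (PerfectMatching n), IsIntersectingFamily F →
      (F.ncard = (2 * (n - 1) - 1)‼ ↔ IsTriviallyIntersecting F)) := by
  refine ⟨fun F ⟨hF, hmax⟩ => ?_, fun F hF => ⟨hF.isTriviallyIntersecting hn, ?_⟩⟩
  · have hij : (⟨0, by omega⟩ : Fin (2 * n)) ≠ ⟨1, by omega⟩ := by simp
    refine hF.isTriviallyIntersecting hn (le_antisymm (hF.ncard_le hn) ?_)
    rw [← ncard_edgeFamily hn hij]
    exact hmax _ (isIntersectingFamily_edgeFamily _ _)
  · rintro ⟨i, j, hij, rfl⟩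
    exact ncard_edgeFamily hn hij
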